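/- The game is played on the square grid $\mathbb{Z}^2$ (first coordinate to the right, second coordinate upwards), where each position has four neighbors and $\mathrm{dist}$ is the graph distance. A configuration is a finite set of positions, each occupied by one coin. A state $A^{+k}$ consists of a configuration $A$ on the board and $k \in \mathbb{N}$ coins in hand. The allowed actions are: moving a coin of $A$ to an unoccupied position that has at least two neighbors among the other coins of $A$; picking up any coin (it goes to the hand); dropping a coin in hand on an unoccupied position that has at least two neighbors in $A$. Write $A^{+k} \to B^{+k'}$ if the state $B^{+k'}$ can be reached from $A^{+k}$ by a finite (possibly empty) sequence of actions. The span of a configuration $C$ is $\mathrm{span}(C)=\bigcup_{i\ge 0} C_i$, where $C_0=C$ and $C_{i+1}$ is obtained from $C_i$ by adding all positions outside $C_i$ with at least two neighbors in $C_i$. A configuration is minimum if no configuration with the same span has fewer coins. A chain between $c$ and $c'$ is a configuration formed by a sequence of coins $c=c_1,\dots,c_N=c'$ with $\mathrm{dist}(c_i,c_{i+1})\in\{1,2\}$ for all $1\le i<N$. Let $m,n\ge 1$ and let $R$ be an $m\times n$ rectangle, i.e. $R=I\times J$ with $I,J\subset\mathbb{Z}$ intervals of cardinality $m$ and $n$ respectively.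 The canonical 'L' of $R$ is the minimum chain $L$ between the top-left and bottom-right corners of $R$ that is contained in the union of the leftmost column and the bottom row of $R$ and, if $m+n$ is odd, contains two adjacent coins in the top-left corner (the corner and the position just below it) if $n$ is even, or in the bottom-right corner (the corner and the position just to its left) if $m$ is even. Lemma. Let $m,n\ge 1$, let $L$ be the canonical 'L' of an $m\times n$ rectangle, and let $k\in\mathbb{N}$. If a configuration $C\subseteq\mathrm{span}(L)$ satisfies $$|C|<\min\left(\left\lceil\frac{m+n}{2}\right\rceil-\left\lceil\frac{\min(m,n)}{2}\right\rceil+(k-1),\ 2(k-1)\right),$$ then $L^{+k}\to C^{+(k+|L|-|C|)}$ (in particular $k+|L|-|C|\ge 0$). -/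

import Mathlib

namespace CoinGame

/-- A position of the square grid `ℤ²`: the first coordinate increases to the right, the second
one upwards. -/
abbrev Pos : Type := ℤ × ℤ

/-- A configuration: the finite set of occupied positions. -/
abbrev Config : Type := Finset Pos

/-- The graph distance of the square grid. -/
def gridDist (p q : Pos) : ℕ := (p.1 - q.1).natAbs + (p.2 - q.2).natAbs

/-- The position `p` has at least two neighbours in `S`. -/
def HasTwoNeighbors (S : Set Pos) (p : Pos) : Prop :=
  ∃ q₁ ∈ S, ∃ q₂ ∈ S, q₁ ≠ q₂ ∧ gridDist p q₁ = 1 ∧ gridDist p q₂ = 1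

/-- One action of the player, who has the configuration `A` on the board and `k` coins in hand
(the state `(A, k)`): moving a coin `c` to a free position `p` so that it then has at least two
other coins adjacent to it, picking up any coin, or dropping a coin in hand on a free position with
at least two neighbouring coins. -/
inductive Step : Config × ℕ → Config × ℕ → Prop
  | move (A : Config) (k : ℕ) (c p : Pos) (hc : c ∈ A) (hp : p ∉ A)
      (h : HasTwoNeighbors (A.erase c : Finset Pos) p) :
      Step (A, k) (insert p (A.erase c), k)
  | pickUp (A : Config) (k : ℕ) (c : Pos) (hc : c ∈ A) :
      Step (A, k) (A.erase c, k + 1)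
  | drop (A : Config) (k : ℕ) (p : Pos) (hp : p ∉ A) (h : HasTwoNeighbors A p) :
      Step (A, k + 1) (insert p A, k)

/-- `A^{+k} → B^{+k'}`: some finite (possibly empty) sequence of actions leads from the
configuration `A` with `k` coins in hand to the configuration `B` with `k'` coins in hand. -/
def Reaches (A : Config) (k : ℕ) (B : Config) (k' : ℕ) : Prop :=
  Relation.ReflTransGen Step (A, k) (B, k')

/-- The positions outside `S` that have at least two neighbours in `S`. -/
def adj (S : Set Pos) : Set Pos := {p | p ∉ S ∧ HasTwoNeighbors S p}

/-- The non-decreasing sequence `C₀ = C`, `C_{i+1} = C_i ∪ Adj(C_i)`. -/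
def spanSeq (C : Config) : ℕ → Set Pos
  | 0 => C
  | i + 1 => spanSeq C i ∪ adj (spanSeq C i)

/-- The span of `C`: the limit of the non-decreasing sequence `spanSeq C`. -/
def span (C : Config) : Set Pos := ⋃ i, spanSeq C i

/-- `C` has the least cardinality among the configurations with the same span. -/
def IsMinimum (C : Config) : Prop :=
  ∀ C' : Config, span C' = span C → C.card ≤ C'.card

/-- `C` is a chain between `c` and `c'`: it is formed by a sequence of coins that starts at `c`,
ends at `c'`, and in which consecutive coins are at distance 1 or 2. -/
def IsChainBetween (C : Config) (c c' : Pos) : Prop :=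
  ∃ l : List Pos, l.toFinset = C ∧ l.head? = some c ∧ l.getLast? = some c' ∧
    l.IsChain (fun p q => gridDist p q = 1 ∨ gridDist p q = 2)

/-- `L` is the canonical 'L' of the `m × n` rectangle `R = [a, a + m - 1] × [b, b + n - 1]`, with
`m` columns and `n` rows (`m, n ≥ 1`). -/
structure IsCanonicalL (a b : ℤ) (m n : ℕ) (L : Config) : Prop where
  /-- `L` is a chain between the top-left and the bottom-right corner of `R`. -/
  chain : IsChainBetween L (a, b + n - 1) (a + m - 1, b)
  /-- `L` is contained in the union of the leftmost column and the bottom row of `R`. -/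
  hugs : ∀ p ∈ L, (p.1 = a ∧ b ≤ p.2 ∧ p.2 ≤ b + n - 1) ∨ (p.2 = b ∧ a ≤ p.1 ∧ p.1 ≤ a + m - 1)
  /-- `L` is a minimum configuration. -/
  minimum : IsMinimum L
  /-- If `m + n` is odd and `n` is even, there are two adjacent coins in the top-left corner. -/
  topLeft : Odd (m + n) → Even n → (a, b + n - 1) ∈ L ∧ (a, b + n - 2) ∈ L
  /-- If `m + n` is odd and `m` is even, there are two adjacent coins in the bottom-right
  corner. -/
  bottomRight : Odd (m + n) → Even m → (a + m - 1, b) ∈ L ∧ (a + m - 2, b) ∈ L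

end CoinGame

/-!
Write `Q = [a, c] × [b, d]` for the rectangle. The coins on the board are regarded as a movable
scaffold, which is a chain between the top-left and the bottom-right corner of a subrectangle, and a
set `X` of coins that stay where they are until the end (`Reshapes`). As long as two coins are to
spare, a chain that descends monotonically can be flipped across a unit square: put the two spare
coins on two opposite corners of the square, and carry the chain's coin from the third corner to the
fourth (`reshapes_flip`). Hence the chain can be swept across its whole rectangle
(`reshapes_diagChain`), passing next to each position, and any set of positions of the rectangle can
be filled as long as two coins remain in hand (`boardReaches_place`).

A chain in a rectangle with `m` columns and `n` rows has `⌈(m + n) / 2⌉` coins, so about half a coin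
is gained for each row whose target positions are filled and which the chain then leaves
(`reshapes_removeTop`, `reshapes_removeBottom`). Let `m ≤ n`; otherwise the two coordinates are
exchanged. If the rows are filled from the top to the bottom, the only obstacle is a first batch of
rows with so many coins that the gains so far do not pay for them (`boardReaches_sweep`). But in
this case, by the two bounds on `|C|`, the remaining rows at the bottom contain few coins: they can
all be placed at once, and retracting the chain to the rows above gains at least as many. This
leaves a smaller rectangle for which both bounds still hold, and induction applies
(`boardReaches_of_card_le`).

If `m + n` is odd, it is a matter of parity whether leaving a row gains a coin. A minimum chain then
has a pair of adjacent coins: to gain from removing bottom rows its coins should have the parity of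
the top-left corner, to gain from removing top rows that of the bottom-right corner. Along the left
column and the bottom row, one can be turned into the other (`reshapes_alternating`), and the same
argument brings the given chain into this form.
-/

namespace CoinGame

/-! ### Boards reachable with a fixed supply of coins -/

/-- With `N` coins in total, those that are not on the board being in hand, the board `B` can be
reached from the board `A`. -/
def BoardReaches (N : ℕ) (A B : Config) : Prop :=
  A.card ≤ N ∧ B.card ≤ N ∧ Reaches A (N - A.card) B (N - B.card)

theorem BoardReaches.refl {N : ℕ} {A : Config} (h : A.card ≤ N) : BoardReaches N A A :=
  ⟨h, h, Relation.ReflTransGen.refl⟩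

theorem BoardReaches.trans {N : ℕ} {A B D : Config} (h₁ : BoardReaches N A B)
    (h₂ : BoardReaches N B D) : BoardReaches N A D :=
  ⟨h₁.1, h₂.2.1, h₁.2.2.trans h₂.2.2⟩

theorem HasTwoNeighbors.mono {S T : Set Pos} {p : Pos} (h : HasTwoNeighbors S p) (hST : S ⊆ T) :
    HasTwoNeighbors T p := by
  obtain ⟨q₁, h₁, q₂, h₂, h⟩ := h
  exact ⟨q₁, hST h₁, q₂, hST h₂, h⟩

theorem boardReaches_of_subset {N : ℕ} {A B : Config} (hBA : B ⊆ A) (hA : A.card ≤ N) :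
    BoardReaches N A B := by
  induction A using Finset.strongInduction with
  | H A ih =>
    by_cases h : B = A
    · subst h; exact BoardReaches.refl hA
    · obtain ⟨c, hcA, hcB⟩ := Finset.exists_of_ssubset (hBA.ssubset_of_ne h)
      have hcard := Finset.card_erase_of_mem hcA
      have hpos : 0 < A.card := Finset.card_pos.2 ⟨c, hcA⟩
      have hstep : BoardReaches N A (A.erase c) := by
        refine ⟨hA, by omega, ?_⟩
        have := Step.pickUp A (N - A.card) c hcA
        rw [show N - (A.erase c).card = N - A.card + 1 by omega]
        exact Relation.ReflTransGen.single this
      exact hstep.trans (ih _ (Finset.erase_ssubset hcA)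
        (fun x hx => Finset.mem_erase.2 ⟨fun e => hcB (e ▸ hx), hBA hx⟩) (by omega))

theorem boardReaches_insert {N : ℕ} {A : Config} {p : Pos} (hA : A.card + 1 ≤ N)
    (h : p ∈ A ∨ HasTwoNeighbors A p) : BoardReaches N A (insert p A) := by
  by_cases hp : p ∈ A
  · rw [Finset.insert_eq_of_mem hp]
    exact BoardReaches.refl (by omega)
  · have hcard := Finset.card_insert_of_notMem hp
    refine ⟨by omega, by omega, ?_⟩
    have := Step.drop A (N - (insert p A).card) p hp (h.resolve_left hp)
    rw [show N - A.card = N - (insert p A).card + 1 by omega]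
    exact Relation.ReflTransGen.single this

/-- The scaffold `A` can be turned into the scaffold `B`, which has no more coins, next to any set
`X` of coins that stays where it is, provided that two coins are to spare. The coins of `X` are
counted in full even where `X` meets the scaffold. -/
def Reshapes (A B : Config) : Prop :=
  B.card ≤ A.card ∧ ∀ (X : Config) (N : ℕ), A.card + X.card + 2 ≤ N →
    BoardReaches N (A ∪ X) (B ∪ X)

theorem Reshapes.trans {A B D : Config} (h₁ : Reshapes A B) (h₂ : Reshapes B D) :
    Reshapes A D :=
  ⟨h₂.1.trans h₁.1, fun X N hN => (h₁.2 X N hN).trans (h₂.2 X N (by have := h₁.1; omega))⟩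

theorem reshapes_of_subset {A B : Config} (h : B ⊆ A) : Reshapes A B :=
  ⟨Finset.card_le_card h, fun X N hN => boardReaches_of_subset (Finset.union_subset_union_left h)
    (by have := Finset.card_union_le A X; omega)⟩

theorem Reshapes.refl (A : Config) : Reshapes A A := reshapes_of_subset (Finset.Subset.refl _)

theorem card_insert_erase_le {A : Config} {p q : Pos} (hp : p ∈ A) :
    (insert q (A.erase p)).card ≤ A.card := by
  have h₁ := Finset.card_insert_le q (A.erase p)
  have h₂ := Finset.card_erase_add_one hp
  omega

/-- A coin of a scaffold moves across a unit square: fill the two other corners `u` and `v` of the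
square, take the coin away, and drop it on the opposite corner. -/
theorem reshapes_flip {A : Config} {p q u v : Pos} (hp : p ∈ A)
    (hu : u ∈ A ∨ HasTwoNeighbors A u) (hv : v ∈ A ∨ HasTwoNeighbors A v) (huv : u ≠ v)
    (hqu : gridDist q u = 1) (hqv : gridDist q v = 1) :
    Reshapes A (insert q (A.erase p)) := by
  refine ⟨card_insert_erase_le hp, fun X N hN => ?_⟩
  have key : ∀ {w : Pos} {T : Config}, A ∪ X ⊆ T → (w ∈ A ∨ HasTwoNeighbors A w) →
      (w ∈ T ∨ HasTwoNeighbors T w) := by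
    intro w T hT h
    have hAT : A ⊆ T := Finset.subset_union_left.trans hT
    exact h.imp (fun h => hAT h) (fun h => h.mono (by exact_mod_cast hAT))
  have hAX := Finset.card_union_le A X
  have h₁ : BoardReaches N (A ∪ X) (insert u (A ∪ X)) :=
    boardReaches_insert (by omega) (key (Finset.Subset.refl _) hu)
  have hc₁ := Finset.card_insert_le u (A ∪ X)
  have h₂ : BoardReaches N (insert u (A ∪ X)) (insert v (insert u (A ∪ X))) :=
    boardReaches_insert (by omega) (key (Finset.subset_insert _ _) hv)
  have hc₂ := Finset.card_insert_le v (insert u (A ∪ X))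
  set T : Config := insert v (insert u (A.erase p ∪ X)) with hT
  have hTsub : T ⊆ insert v (insert u (A ∪ X)) :=
    Finset.insert_subset_insert _ (Finset.insert_subset_insert _
      (Finset.union_subset_union_left (Finset.erase_subset _ _)))
  have h₃ : BoardReaches N (insert v (insert u (A ∪ X))) T :=
    boardReaches_of_subset hTsub (by omega)
  have hTcard : T.card + 1 ≤ N := by
    have e₁ : T.card ≤ _ := Finset.card_insert_le v (insert u (A.erase p ∪ X))
    have e₂ := Finset.card_insert_le u (A.erase p ∪ X)
    have e₃ := Finset.card_union_le (A.erase p) X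
    have e₄ := Finset.card_erase_add_one hp
    omega
  have h₄ : BoardReaches N T (insert q T) :=
    boardReaches_insert hTcard (Or.inr ⟨u, by simp [hT], v, by simp [hT], huv, hqu, hqv⟩)
  have hc₄ := Finset.card_insert_le q T
  have h₅ : BoardReaches N (insert q T) (insert q (A.erase p) ∪ X) := by
    refine boardReaches_of_subset ?_ (by omega)
    rw [Finset.insert_union]
    exact Finset.insert_subset_insert _
      ((Finset.subset_insert _ _).trans (Finset.subset_insert _ _))
  exact (((h₁.trans h₂).trans h₃).trans h₄).trans h₅

/-- A coin of a scaffold is exchanged for a coin on a position with two neighbours. -/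
theorem reshapes_exchange {A : Config} {p u : Pos} (hp : p ∈ A) (hu : HasTwoNeighbors A u) :
    Reshapes A (insert u (A.erase p)) := by
  refine ⟨card_insert_erase_le hp, fun X N hN => ?_⟩
  have hAX := Finset.card_union_le A X
  have h₁ : BoardReaches N (A ∪ X) (insert u (A ∪ X)) :=
    boardReaches_insert (by omega) (Or.inr (hu.mono (by simp)))
  have hc₁ := Finset.card_insert_le u (A ∪ X)
  refine h₁.trans (boardReaches_of_subset ?_ (by omega))
  rw [Finset.insert_union]
  exact Finset.insert_subset_insert _ (Finset.union_subset_union_left (Finset.erase_subset _ _))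

/-! ### Monotone chains in a rectangle -/

/-- The positions of the rectangle `[a, c] × [b, d]`. -/
noncomputable def rect (a b c d : ℤ) : Config := Finset.Icc a c ×ˢ Finset.Icc b d

theorem mem_rect {a b c d x y : ℤ} :
    (x, y) ∈ rect a b c d ↔ (a ≤ x ∧ x ≤ c) ∧ b ≤ y ∧ y ≤ d := by
  simp [rect]

/-- A chain between the top-left and the bottom-right corner of `[a, c] × [b, d]`. It follows the
diagonal `x + y = s + 2` in the columns up to `j` and the diagonal `x + y = s` from there on; where
these diagonals leave the rectangle, it follows the boundary. Apart from the two corners, it has its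
coins on the positions for which `x + y` has the parity of `s`. Each increase of `j` by one moves
at most one coin, by `(1, 1)`. -/
noncomputable def brokenChain (a b c d s j : ℤ) : Config :=
  (rect a b c d).filter fun p =>
    p = (a, d) ∨ p = (c, b) ∨ ((p.1 + p.2 - s) % 2 = 0 ∧
      ((p.1 + p.2 ≤ s ∧ (p.1 = c ∨ p.2 = d ∨ (p.1 + p.2 = s ∧ j ≤ p.1))) ∨
       (s < p.1 + p.2 ∧ (p.1 = a ∨ p.2 = b ∨ (p.1 + p.2 = s + 2 ∧ p.1 ≤ j)))))

/-- The chain along the diagonal `x + y = s` and, where this diagonal lies outside the rectangle,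
along the boundary. -/
noncomputable def diagChain (a b c d s : ℤ) : Config := brokenChain a b c d s a

theorem mem_brokenChain {a b c d s j x y : ℤ} :
    (x, y) ∈ brokenChain a b c d s j ↔ ((a ≤ x ∧ x ≤ c) ∧ b ≤ y ∧ y ≤ d) ∧
      ((x = a ∧ y = d) ∨ (x = c ∧ y = b) ∨ ((x + y - s) % 2 = 0 ∧
      ((x + y ≤ s ∧ (x = c ∨ y = d ∨ (x + y = s ∧ j ≤ x))) ∨
       (s < x + y ∧ (x = a ∨ y = b ∨ (x + y = s + 2 ∧ x ≤ j)))))) := by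
  simp [brokenChain, mem_rect]

theorem mem_diagChain {a b c d s x y : ℤ} :
    (x, y) ∈ diagChain a b c d s ↔ ((a ≤ x ∧ x ≤ c) ∧ b ≤ y ∧ y ≤ d) ∧
      ((x = a ∧ y = d) ∨ (x = c ∧ y = b) ∨ ((x + y - s) % 2 = 0 ∧
      ((x + y ≤ s ∧ (x = c ∨ y = d ∨ x + y = s)) ∨
       (s < x + y ∧ (x = a ∨ y = b))))) := by
  rw [diagChain, mem_brokenChain]; omega

theorem brokenChain_right (a b c d s : ℤ) :
    brokenChain a b c d s c = diagChain a b c d (s + 2) := by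
  ext ⟨x, y⟩; rw [mem_brokenChain, mem_diagChain]; omega

theorem hasTwoNeighbors_of_pair {A : Config} {p q r : Pos} (hq : q ∈ A) (hr : r ∈ A) (hqr : q ≠ r)
    (hpq : gridDist p q = 1) (hpr : gridDist p r = 1) : HasTwoNeighbors A p :=
  ⟨q, hq, r, hr, hqr, hpq, hpr⟩

/-- The corner `(j + 1, s - j)` of the square in which a broken chain is flipped. Here `i` is the
position of the break before or after the flip, and `q` the corner of the square that the chain
occupies. -/
theorem brokenChain_right_corner {a b c d s j i : ℤ} {q : Pos} (hj : a ≤ j) (hjc : j < c)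
    (hb : b ≤ s - j) (hd : s - j < d) (hi : i = j ∨ i = j + 1)
    (hq : q ∈ brokenChain a b c d s i) (hq' : q = (j, s - j) ∨ q = (j + 1, s - j + 1)) :
    (j + 1, s - j) ∈ brokenChain a b c d s i ∨
      HasTwoNeighbors (brokenChain a b c d s i) (j + 1, s - j) := by
  have hdist : gridDist (j + 1, s - j) q = 1 := by
    rcases hq' with rfl | rfl <;> simp only [gridDist] <;> omega
  by_cases h : s - j = b
  · by_cases h' : j + 1 = c
    · left; rw [mem_brokenChain]; omega
    · right
      refine hasTwoNeighbors_of_pair hq (r := (j + 2, s - j)) ?_ ?_ hdist ?_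
      · rw [mem_brokenChain]; omega
      · rcases hq' with rfl | rfl <;> simp
      · simp only [gridDist]; omega
  · right
    refine hasTwoNeighbors_of_pair hq (r := (j + 1, s - j - 1)) ?_ ?_ hdist ?_
    · rw [mem_brokenChain]; omega
    · rcases hq' with rfl | rfl <;> simp
      omega
    · simp only [gridDist]; omega

/-- The corner `(j, s - j + 1)` of the square in which a broken chain is flipped. -/
theorem brokenChain_left_corner {a b c d s j i : ℤ} {q : Pos} (hj : a ≤ j) (hjc : j < c)
    (hb : b ≤ s - j) (hd : s - j < d) (hi : i = j ∨ i = j + 1)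
    (hq : q ∈ brokenChain a b c d s i) (hq' : q = (j, s - j) ∨ q = (j + 1, s - j + 1)) :
    (j, s - j + 1) ∈ brokenChain a b c d s i ∨
      HasTwoNeighbors (brokenChain a b c d s i) (j, s - j + 1) := by
  have hdist : gridDist (j, s - j + 1) q = 1 := by
    rcases hq' with rfl | rfl <;> simp only [gridDist] <;> omega
  by_cases h : s - j + 1 = d
  · by_cases h' : j = a
    · left; rw [mem_brokenChain]; omega
    · right
      refine hasTwoNeighbors_of_pair hq (r := (j - 1, s - j + 1)) ?_ ?_ hdist ?_
      · rw [mem_brokenChain]; omega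
      · rcases hq' with rfl | rfl <;> simp
        omega
      · simp only [gridDist]; omega
  · right
    refine hasTwoNeighbors_of_pair hq (r := (j, s - j + 2)) ?_ ?_ hdist ?_
    · rw [mem_brokenChain]; omega
    · rcases hq' with rfl | rfl <;> simp
    · simp only [gridDist]; omega

theorem reshapes_brokenChain_succ (a b c d s j : ℤ) :
    Reshapes (brokenChain a b c d s j) (brokenChain a b c d s (j + 1)) := by
  by_cases h : a ≤ j ∧ j < c ∧ b ≤ s - j ∧ s - j < d
  · obtain ⟨h₁, h₂, h₃, h₄⟩ := h
    have hp : (j, s - j) ∈ brokenChain a b c d s j := by rw [mem_brokenChain]; omega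
    refine (reshapes_flip (q := (j + 1, s - j + 1)) hp
      (brokenChain_right_corner h₁ h₂ h₃ h₄ (Or.inl rfl) hp (Or.inl rfl))
      (brokenChain_left_corner h₁ h₂ h₃ h₄ (Or.inl rfl) hp (Or.inl rfl))
      (by simp) (by simp [gridDist]) (by simp [gridDist])).trans
      (reshapes_of_subset ?_)
    rintro ⟨x, y⟩ hxy
    simp only [Finset.mem_insert, Finset.mem_erase, Prod.mk.injEq, ne_eq]
    rw [mem_brokenChain] at hxy ⊢
    omega
  · apply reshapes_of_subset
    rintro ⟨x, y⟩ hxy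
    rw [mem_brokenChain] at hxy ⊢
    omega

theorem reshapes_brokenChain_pred (a b c d s j : ℤ) :
    Reshapes (brokenChain a b c d s (j + 1)) (brokenChain a b c d s j) := by
  by_cases h : a ≤ j ∧ j < c ∧ b ≤ s - j ∧ s - j < d
  · obtain ⟨h₁, h₂, h₃, h₄⟩ := h
    have hp : (j + 1, s - j + 1) ∈ brokenChain a b c d s (j + 1) := by
      rw [mem_brokenChain]; omega
    refine (reshapes_flip (q := (j, s - j)) hp
      (brokenChain_right_corner h₁ h₂ h₃ h₄ (Or.inr rfl) hp (Or.inr rfl))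
      (brokenChain_left_corner h₁ h₂ h₃ h₄ (Or.inr rfl) hp (Or.inr rfl))
      (by simp) (by simp [gridDist]) (by simp [gridDist])).trans
      (reshapes_of_subset ?_)
    rintro ⟨x, y⟩ hxy
    simp only [Finset.mem_insert, Finset.mem_erase, Prod.mk.injEq, ne_eq]
    rw [mem_brokenChain] at hxy ⊢
    omega
  · apply reshapes_of_subset
    rintro ⟨x, y⟩ hxy
    rw [mem_brokenChain] at hxy ⊢
    omega

theorem reshapes_brokenChain_add (a b c d s : ℤ) (i : ℕ) :
    Reshapes (brokenChain a b c d s a) (brokenChain a b c d s (a + i)) ∧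
      Reshapes (brokenChain a b c d s (a + i)) (brokenChain a b c d s a) := by
  induction i with
  | zero => simp [Reshapes.refl]
  | succ i ih =>
    push_cast
    rw [← add_assoc]
    exact ⟨ih.1.trans (reshapes_brokenChain_succ ..), (reshapes_brokenChain_pred ..).trans ih.2⟩

theorem reshapes_diagChain_two {a b c d : ℤ} (hac : a ≤ c) (s : ℤ) :
    Reshapes (diagChain a b c d s) (diagChain a b c d (s + 2)) ∧
      Reshapes (diagChain a b c d (s + 2)) (diagChain a b c d s) := by
  have h := reshapes_brokenChain_add a b c d s (c - a).toNat
  rw [show a + ((c - a).toNat : ℤ) = c by omega, brokenChain_right] at h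
  exact h

/-- A chain can be swept across the whole rectangle. -/
theorem reshapes_diagChain {a b c d s t : ℤ} (hac : a ≤ c) (hst : (s - t) % 2 = 0) :
    Reshapes (diagChain a b c d s) (diagChain a b c d t) := by
  have key : ∀ (i : ℕ) (s : ℤ), Reshapes (diagChain a b c d s) (diagChain a b c d (s + 2 * i)) ∧
      Reshapes (diagChain a b c d (s + 2 * i)) (diagChain a b c d s) := by
    intro i s
    induction i with
    | zero => simp [Reshapes.refl]
    | succ i ih =>
      have h := reshapes_diagChain_two (b := b) (d := d) hac (s + 2 * i)
      rw [show s + 2 * ((i + 1 : ℕ) : ℤ) = s + 2 * i + 2 by push_cast; ring]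
      exact ⟨ih.1.trans h.1, h.2.trans ih.2⟩
  rcases le_total s t with h | h
  · have := (key ((t - s) / 2).toNat s).1
    rwa [show s + 2 * (((t - s) / 2).toNat : ℤ) = t by omega] at this
  · have := (key ((s - t) / 2).toNat t).2
    rwa [show t + 2 * (((s - t) / 2).toNat : ℤ) = s by omega] at this

/-- Each position of the rectangle belongs to a chain of either parity or can receive a coin next
to it. -/
theorem mem_or_hasTwoNeighbors_diagChain {a b c d s x y : ℤ} (hp : (x, y) ∈ rect a b c d)
    (hs : s = x + y ∨ s = x + y - 1) :
    (x, y) ∈ diagChain a b c d s ∨ HasTwoNeighbors (diagChain a b c d s) (x, y) := by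
  rw [mem_rect] at hp
  by_cases hmem : (x, y) ∈ diagChain a b c d s
  · exact Or.inl hmem
  · right
    rw [mem_diagChain] at hmem
    by_cases hx : x = a
    · by_cases hy : y = b
      · refine hasTwoNeighbors_of_pair (q := (x + 1, y)) (r := (x, y + 1)) ?_ ?_ (by simp)
          (by simp [gridDist]) (by simp [gridDist]) <;> rw [mem_diagChain] <;> omega
      · refine hasTwoNeighbors_of_pair (q := (x, y - 1)) (r := (x, y + 1)) ?_ ?_ ?_
          (by simp [gridDist]) (by simp [gridDist])
        · rw [mem_diagChain]; omega
        · rw [mem_diagChain]; omega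
        · simp only [ne_eq, Prod.mk.injEq]; omega
    · by_cases hy : y = b
      · refine hasTwoNeighbors_of_pair (q := (x + 1, y)) (r := (x - 1, y)) ?_ ?_ ?_
          (by simp [gridDist]) (by simp [gridDist])
        · rw [mem_diagChain]; omega
        · rw [mem_diagChain]; omega
        · simp only [ne_eq, Prod.mk.injEq]; omega
      · refine hasTwoNeighbors_of_pair (q := (x, y - 1)) (r := (x - 1, y)) ?_ ?_ (by simp)
          (by simp [gridDist]) (by simp [gridDist]) <;> rw [mem_diagChain] <;> omega

/-- With two spare coins beyond those to be placed, any set of positions of the rectangle can be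
filled: for each of them, sweep the chain there, drop the coin, and sweep the chain back. -/
theorem boardReaches_place {a b c d s : ℤ} (hac : a ≤ c) {N : ℕ} (X Y : Config)
    (hY : Y ⊆ rect a b c d) (hN : (diagChain a b c d s).card + X.card + Y.card + 2 ≤ N) :
    BoardReaches N (diagChain a b c d s ∪ X) (diagChain a b c d s ∪ (X ∪ Y)) := by
  induction Y using Finset.induction_on generalizing X with
  | empty =>
    have := Finset.card_union_le (diagChain a b c d s) X
    simpa using BoardReaches.refl (N := N) (A := diagChain a b c d s ∪ X) (by omega)
  | insert p Y hp ih =>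
    obtain ⟨x, y⟩ := p
    rw [Finset.card_insert_of_notMem hp] at hN
    have hpr : (x, y) ∈ rect a b c d := hY (Finset.mem_insert_self _ _)
    obtain ⟨t, hts, ht⟩ : ∃ t, (s - t) % 2 = 0 ∧ (t = x + y ∨ t = x + y - 1) := by
      by_cases h : (s - (x + y)) % 2 = 0
      · exact ⟨x + y, h, Or.inl rfl⟩
      · exact ⟨x + y - 1, by omega, Or.inr rfl⟩
    have hst := reshapes_diagChain (b := b) (d := d) hac hts
    have hts' := reshapes_diagChain (b := b) (d := d) hac (s := t) (t := s) (by omega)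
    have hc := Finset.card_union_le (diagChain a b c d t) X
    have hX := Finset.card_insert_le (x, y) X
    have h₁ := hst.2 X N (by omega)
    have h₂ : BoardReaches N (diagChain a b c d t ∪ X) (diagChain a b c d t ∪ insert (x, y) X) := by
      rw [Finset.union_insert]
      refine boardReaches_insert (by have := hst.1; omega) ?_
      exact (mem_or_hasTwoNeighbors_diagChain hpr ht).imp
        (fun h => Finset.mem_union_left _ h) (fun h => h.mono (by simp))
    have h₃ := hts'.2 (insert (x, y) X) N (by have := hst.1; omega)
    have h₄ := ih (insert (x, y) X) ((Finset.subset_insert _ _).trans hY) (by omega)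
    rw [Finset.union_insert (x, y) X Y, ← Finset.insert_union]
    exact ((h₁.trans h₂).trans h₃).trans h₄

/-! ### Thinning out a chain along a path -/

/-- The indices `0, 2, 4, …` up to `M`, and `M`. -/
def alternating (M : ℕ) : Finset ℕ := (Finset.range (M + 1)).filter fun t => t % 2 = 0 ∨ t = M

theorem card_alternating (M : ℕ) : (alternating M).card = (M + 1) / 2 + 1 := by
  have h : alternating M = (Finset.range ((M + 1) / 2 + 1)).image fun i => min (2 * i) M := by
    ext t
    simp only [alternating, Finset.mem_filter, Finset.mem_range, Finset.mem_image]
    constructor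
    · rintro ⟨h₁, h₂⟩
      exact ⟨(t + 1) / 2, by omega, by omega⟩
    · rintro ⟨i, h₁, h₂⟩
      omega
  rw [h, Finset.card_image_of_injOn, Finset.card_range]
  intro i hi j hj hij
  simp only [Finset.coe_range, Set.mem_Iio] at hi hj hij
  omega

/-- Along a path, a chain that leaves out no two consecutive positions can be turned into the one
that takes every second position, and the last one. This is done from the start of the path, one
coin at a time: if position `2 i + 2` is empty, the coin from `2 i + 1` is brought there. -/
theorem reshapes_alternating {γ : ℕ → Pos} {M : ℕ} {D : Finset ℕ} (hγ : Set.InjOn γ (Set.Iic M))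
    (hadj : ∀ t < M, gridDist (γ t) (γ (t + 1)) = 1 ∧ gridDist (γ (t + 1)) (γ t) = 1)
    (hM : M ∈ D) (hD : ∀ t < M, t ∈ D ∨ t + 1 ∈ D) (h0 : 0 ∈ D) :
    Reshapes (D.image γ) ((alternating M).image γ) := by
  set E : ℕ → Finset ℕ := fun i => (Finset.range (M + 1)).filter fun t =>
    if t ≤ 2 * i then t % 2 = 0 ∨ t = M else t ∈ D with hE
  have mem_E : ∀ i t, t ∈ E i ↔ t ≤ M ∧ (t ≤ 2 * i ∧ (t % 2 = 0 ∨ t = M) ∨ 2 * i < t ∧ t ∈ D) := by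
    intro i t
    simp only [hE, Finset.mem_filter, Finset.mem_range, Nat.lt_succ_iff]
    split_ifs with h
    · simp [h]
    · simp [h, not_le.1 h]
  have step : ∀ i, Reshapes ((E i).image γ) ((E (i + 1)).image γ) := by
    intro i
    by_cases h : 2 * i + 2 ≤ M ∧ 2 * i + 2 ∉ D
    · obtain ⟨h₁, h₂⟩ := h
      have h₃ : 2 * i + 1 ∈ D := (hD (2 * i + 1) (by omega)).resolve_right h₂
      have h₄ : 2 * i + 2 ≠ M := fun e => h₂ (e ▸ hM)
      have h₅ : 2 * i + 3 ∈ D := (hD (2 * i + 2) (by omega)).resolve_left h₂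
      have m₁ : γ (2 * i + 1) ∈ (E i).image γ :=
        Finset.mem_image_of_mem _ ((mem_E _ _).2 ⟨by omega, Or.inr ⟨by omega, h₃⟩⟩)
      have m₃ : γ (2 * i + 3) ∈ (E i).image γ :=
        Finset.mem_image_of_mem _ ((mem_E _ _).2 ⟨by omega, Or.inr ⟨by omega, h₅⟩⟩)
      refine (reshapes_exchange (u := γ (2 * i + 2)) m₁ (hasTwoNeighbors_of_pair m₁ m₃ ?_
        (hadj _ (by omega)).2 (hadj _ (by omega)).1)).trans (reshapes_of_subset ?_)
      · intro e
        have := hγ (by simp; omega) (by simp; omega) e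
        omega
      · intro x hx
        obtain ⟨t, ht, rfl⟩ := Finset.mem_image.1 hx
        rw [mem_E] at ht
        by_cases e : t = 2 * i + 2
        · subst e; exact Finset.mem_insert_self _ _
        · refine Finset.mem_insert_of_mem (Finset.mem_erase.2 ⟨fun e' => ?_, ?_⟩)
          · have := hγ (by simp; omega) (by simp; omega) e'
            omega
          · refine Finset.mem_image_of_mem _ ((mem_E _ _).2 ⟨ht.1, ?_⟩)
            rcases ht.2 with h | h
            · left; omega
            · right; exact ⟨by omega, h.2⟩
    · apply reshapes_of_subset
      refine Finset.image_subset_image fun t ht => ?_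
      rw [mem_E] at ht ⊢
      refine ⟨ht.1, ?_⟩
      rcases ht.2 with ⟨h₁, h₂⟩ | ⟨h₁, h₂⟩
      · by_cases h₃ : t ≤ 2 * i
        · exact Or.inl ⟨h₃, h₂⟩
        · refine Or.inr ⟨by omega, ?_⟩
          by_cases h₄ : t = M
          · exact h₄ ▸ hM
          · have h₅ : t = 2 * i + 2 := by omega
            subst h₅
            by_contra h₆
            exact h ⟨by omega, h₆⟩
      · exact Or.inr ⟨by omega, h₂⟩
  have all : ∀ i, Reshapes (D.image γ) ((E i).image γ) := by
    intro i
    induction i with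
    | zero =>
      apply reshapes_of_subset
      refine Finset.image_subset_image fun t ht => ?_
      rw [mem_E] at ht
      rcases ht.2 with ⟨h₁, -⟩ | ⟨-, h₂⟩
      · rwa [show t = 0 by omega]
      · exact h₂
    | succ i ih => exact ih.trans (step i)
  have hEM : E M = alternating M := by
    ext t
    rw [mem_E, alternating, Finset.mem_filter, Finset.mem_range]
    omega
  rw [← hEM]
  exact all M

/-! ### The path along the left column and the bottom row -/

/-- The path that runs down the column `a` from `(a, d)` to `(a, b)` and then to the right along the
row `b`. -/
def cornerPath (a b d : ℤ) (t : ℕ) : Pos :=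
  if (t : ℤ) ≤ d - b then (a, d - t) else (a + t - (d - b), b)

theorem cornerPath_eq {a b d : ℤ} {t : ℕ} {x y : ℤ} :
    cornerPath a b d t = (x, y) ↔
      (x = a ∧ b ≤ y ∨ y = b ∧ a ≤ x) ∧ (x - a) + (d - y) = t := by
  unfold cornerPath
  split_ifs with h <;> rw [Prod.mk.injEq] <;> omega

theorem cornerPath_injective (a b d : ℤ) : Function.Injective (cornerPath a b d) := by
  intro s t h
  simp only [cornerPath] at h
  split_ifs at h <;> rw [Prod.mk.injEq] at h <;> omega

theorem gridDist_cornerPath (a b d : ℤ) (t : ℕ) :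
    gridDist (cornerPath a b d t) (cornerPath a b d (t + 1)) = 1 := by
  simp only [cornerPath, gridDist]
  split_ifs <;> push_cast at * <;> omega

theorem gridDist_comm (p q : Pos) : gridDist p q = gridDist q p := by
  simp only [gridDist]; omega

/-- `A` contains a chain between the top-left and the bottom-right corner of `[a, c] × [b, d]` along
the left column and the bottom row: both corners, and one of any two consecutive positions. -/
structure CornerDense (a b c d : ℤ) (A : Config) : Prop where
  topLeft : (a, d) ∈ A
  bottomRight : (c, b) ∈ A
  dense : ∀ t : ℕ, (t : ℤ) < (c - a) + (d - b) →
    cornerPath a b d t ∈ A ∨ cornerPath a b d (t + 1) ∈ A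

variable {a b c d s : ℤ}

theorem CornerDense.reshapes_image {A : Config} (hA : CornerDense a b c d A) (hac : a ≤ c)
    (hbd : b ≤ d) {M : ℕ} (hM : (M : ℤ) = (c - a) + (d - b)) :
    Reshapes A ((alternating M).image (cornerPath a b d)) ∧
      Reshapes A ((alternating M).image fun t => cornerPath a b d (M - t)) := by
  have e₀ : cornerPath a b d 0 = (a, d) := (cornerPath_eq).2 (by omega)
  have e₁ : cornerPath a b d M = (c, b) := (cornerPath_eq).2 (by omega)
  constructor
  · refine Reshapes.trans (reshapes_of_subset
      (B := ((Finset.range (M + 1)).filter (cornerPath a b d · ∈ A)).image (cornerPath a b d)) ?_)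
      (reshapes_alternating (cornerPath_injective a b d).injOn
        (fun t _ => ⟨gridDist_cornerPath a b d t, ?_⟩) ?_ ?_ ?_)
    · intro p hp
      obtain ⟨t, ht, rfl⟩ := Finset.mem_image.1 hp
      exact (Finset.mem_filter.1 ht).2
    · rw [gridDist_comm]; exact gridDist_cornerPath a b d t
    · simp [e₁, hA.bottomRight]
    · intro t ht
      have := hA.dense t (by omega)
      simp only [Finset.mem_filter, Finset.mem_range]
      exact this.imp (fun h => ⟨by omega, h⟩) (fun h => ⟨by omega, h⟩)
    · simp [e₀, hA.topLeft]
  · have e : ∀ t < M, M - t = M - (t + 1) + 1 := by omega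
    refine Reshapes.trans (reshapes_of_subset
      (B := ((Finset.range (M + 1)).filter (fun t => cornerPath a b d (M - t) ∈ A)).image
        (fun t => cornerPath a b d (M - t))) ?_)
      (reshapes_alternating ?_ (fun t ht => ⟨?_, ?_⟩) ?_ ?_ ?_)
    · intro p hp
      obtain ⟨t, ht, rfl⟩ := Finset.mem_image.1 hp
      exact (Finset.mem_filter.1 ht).2
    · intro i hi j hj hij
      have := cornerPath_injective a b d hij
      simp only [Set.mem_Iic] at hi hj
      omega
    · rw [gridDist_comm, e t ht]; exact gridDist_cornerPath a b d _
    · rw [e t ht]; exact gridDist_cornerPath a b d _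
    · simp [e₀, hA.topLeft]
    · intro t ht
      have := hA.dense (M - (t + 1)) (by omega)
      rw [← e t ht] at this
      simp only [Finset.mem_filter, Finset.mem_range]
      exact this.symm.imp (fun h => ⟨by omega, h⟩) (fun h => ⟨by omega, h⟩)
    · simp [e₁, hA.bottomRight]

theorem diagChain_subset_image {M : ℕ}
    (hM : (M : ℤ) = (c - a) + (d - b)) (hs : s = a + b ∨ s = a + b - 1) :
    ((s - (a + d)) % 2 = 0 →
      diagChain a b c d s ⊆ (alternating M).image (cornerPath a b d)) ∧
    ((s - (c + b)) % 2 = 0 →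
      diagChain a b c d s ⊆ (alternating M).image fun t => cornerPath a b d (M - t)) := by
  constructor <;> rintro hpar ⟨x, y⟩ hp <;> rw [mem_diagChain] at hp <;>
    simp only [Finset.mem_image, alternating, Finset.mem_filter, Finset.mem_range]
  · exact ⟨((x - a) + (d - y)).toNat, by omega, (cornerPath_eq).2 (by omega)⟩
  · exact ⟨((c - x) + (y - b)).toNat, by omega, (cornerPath_eq).2 (by omega)⟩

/-- The diagonals `a + b` and `a + b - 1` are those for which the chain runs along the left column
and the bottom row. -/
theorem exists_low_diagonal (a b s : ℤ) : ∃ t, (t = a + b ∨ t = a + b - 1) ∧ (t - s) % 2 = 0 := by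
  by_cases h : (a + b - s) % 2 = 0
  · exact ⟨a + b, Or.inl rfl, h⟩
  · exact ⟨a + b - 1, Or.inr rfl, by omega⟩

theorem CornerDense.reshapes_diagChain {A : Config} (hA : CornerDense a b c d A) (hac : a ≤ c)
    (hbd : b ≤ d) (hs : (s - (a + d)) % 2 = 0 ∨ (s - (c + b)) % 2 = 0) :
    Reshapes A (diagChain a b c d s) := by
  obtain ⟨t, ht, hts⟩ := exists_low_diagonal a b s
  have hM : (((c - a) + (d - b)).toNat : ℤ) = (c - a) + (d - b) := by omega
  refine Reshapes.trans ?_ (CoinGame.reshapes_diagChain hac hts)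
  rcases hs with hs | hs
  · exact (hA.reshapes_image hac hbd hM).1.trans
      (reshapes_of_subset ((diagChain_subset_image hM ht).1 (by omega)))
  · exact (hA.reshapes_image hac hbd hM).2.trans
      (reshapes_of_subset ((diagChain_subset_image hM ht).2 (by omega)))

theorem CornerDense.card_le {A : Config} (hA : CornerDense a b c d A) (hac : a ≤ c)
    (hbd : b ≤ d) : ((c - a) + (d - b) + 1) / 2 + 1 ≤ (A.card : ℤ) := by
  obtain ⟨M, hM⟩ : ∃ M : ℕ, (M : ℤ) = (c - a) + (d - b) := ⟨((c - a) + (d - b)).toNat, by omega⟩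
  have h := (hA.reshapes_image hac hbd hM).1.1
  rw [Finset.card_image_of_injective _ (cornerPath_injective a b d), card_alternating] at h
  omega

/-- The chains whose parity is that of one of the two corners have the least possible number of
coins. -/
theorem card_diagChain_le (hac : a ≤ c) (hbd : b ≤ d)
    (hs : (s - (a + d)) % 2 = 0 ∨ (s - (c + b)) % 2 = 0) :
    ((diagChain a b c d s).card : ℤ) ≤ ((c - a) + (d - b) + 1) / 2 + 1 := by
  obtain ⟨M, hM⟩ : ∃ M : ℕ, (M : ℤ) = (c - a) + (d - b) := ⟨((c - a) + (d - b)).toNat, by omega⟩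
  obtain ⟨t, ht, hts⟩ := exists_low_diagonal a b s
  have h := (CoinGame.reshapes_diagChain (b := b) (d := d) hac hts).1
  have hal := card_alternating M
  rcases hs with hs | hs
  · have h₁ := Finset.card_le_card ((diagChain_subset_image hM ht).1 (by omega))
    have h₂ := Finset.card_image_le (s := alternating M) (f := cornerPath a b d)
    omega
  · have h₁ := Finset.card_le_card ((diagChain_subset_image hM ht).2 (by omega))
    have h₂ := Finset.card_image_le (s := alternating M) (f := fun t => cornerPath a b d (M - t))
    omega

/-- A minimum chain whose coins have the parity of the top-left corner can be turned into one whose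
coins have the parity of the bottom-right corner. -/
theorem reshapes_diagChain_parity (hac : a ≤ c) (hbd : b ≤ d) {t : ℤ}
    (ht : (t - (c + b)) % 2 = 0) : Reshapes (diagChain a b c d s) (diagChain a b c d t) := by
  obtain ⟨r, hr, hrs⟩ := exists_low_diagonal a b s
  refine (CoinGame.reshapes_diagChain hac (show (s - r) % 2 = 0 by omega)).trans
    (CornerDense.reshapes_diagChain ⟨?_, ?_, ?_⟩ hac hbd (Or.inr ht))
  · rw [mem_diagChain]; omega
  · rw [mem_diagChain]; omega
  · intro i hi
    rcases h : cornerPath a b d i with ⟨x, y⟩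
    rcases h' : cornerPath a b d (i + 1) with ⟨x', y'⟩
    rw [cornerPath_eq] at h h'
    rw [mem_diagChain, mem_diagChain]
    push_cast at h'
    obtain ⟨h₁, h₂⟩ := h
    obtain ⟨h₁', h₂'⟩ := h'
    by_cases hpar : (x + y - r) % 2 = 0
    · left; clear h₁' h₂'; omega
    · right
      have : (x' + y' - r) % 2 = 0 := by omega
      clear h₁ h₂ hpar; omega

/-! ### Retracting a chain to a smaller rectangle -/

/-- The rectangle loses its top row. The chain is first swept down to the left column and the bottom
row, where at most one coin has to be moved. -/
theorem reshapes_removeTop (hac : a ≤ c) (hbd : b < d) {t : ℤ} (hst : (s - t) % 2 = 0) :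
    Reshapes (diagChain a b c d s) (diagChain a b c (d - 1) t) := by
  obtain ⟨r, hr, hrs⟩ := exists_low_diagonal a b s
  refine (CoinGame.reshapes_diagChain hac (show (s - r) % 2 = 0 by omega)).trans
    (Reshapes.trans ?_ (CoinGame.reshapes_diagChain hac (show (r - t) % 2 = 0 by omega)))
  have hTL : (a, d) ∈ diagChain a b c d r := by rw [mem_diagChain]; omega
  by_cases h : (a, d - 1) ∈ diagChain a b c d r
  · apply reshapes_of_subset
    rw [mem_diagChain] at h
    rintro ⟨x, y⟩ hp
    rw [mem_diagChain] at hp ⊢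
    omega
  · refine (reshapes_exchange (u := (a, d - 1)) hTL ?_).trans (reshapes_of_subset ?_)
    · rw [mem_diagChain] at h
      by_cases h' : d - 1 = b
      · refine hasTwoNeighbors_of_pair hTL (r := (a + 1, d - 1)) ?_ (by simp) (by simp [gridDist])
          (by simp [gridDist])
        rw [mem_diagChain]; omega
      · refine hasTwoNeighbors_of_pair hTL (r := (a, d - 2)) ?_ (by simp; omega)
          (by simp [gridDist]) (by simp only [gridDist]; omega)
        rw [mem_diagChain]; omega
    · rintro ⟨x, y⟩ hp
      simp only [Finset.mem_insert, Finset.mem_erase, Prod.mk.injEq, ne_eq]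
      rw [mem_diagChain] at hp ⊢
      omega

/-- The rectangle loses its bottom row. The chain is first swept up to the top row and the right
column, where at most one coin has to be moved. -/
theorem reshapes_removeBottom (hac : a ≤ c) (hbd : b < d) {t : ℤ} (hst : (s - t) % 2 = 0) :
    Reshapes (diagChain a b c d s) (diagChain a (b + 1) c d t) := by
  obtain ⟨r, hr, hrs⟩ : ∃ r, (r = c + d ∨ r = c + d + 1) ∧ (r - s) % 2 = 0 := by
    by_cases h : (c + d - s) % 2 = 0
    · exact ⟨c + d, Or.inl rfl, h⟩
    · exact ⟨c + d + 1, Or.inr rfl, by omega⟩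
  refine (CoinGame.reshapes_diagChain hac (show (s - r) % 2 = 0 by omega)).trans
    (Reshapes.trans ?_ (CoinGame.reshapes_diagChain hac (show (r - t) % 2 = 0 by omega)))
  have hBR : (c, b) ∈ diagChain a b c d r := by rw [mem_diagChain]; omega
  by_cases h : (c, b + 1) ∈ diagChain a b c d r
  · apply reshapes_of_subset
    rw [mem_diagChain] at h
    rintro ⟨x, y⟩ hp
    rw [mem_diagChain] at hp ⊢
    omega
  · refine (reshapes_exchange (u := (c, b + 1)) hBR ?_).trans (reshapes_of_subset ?_)
    · rw [mem_diagChain] at h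
      by_cases h' : b + 1 = d
      · refine hasTwoNeighbors_of_pair hBR (r := (c - 1, b + 1)) ?_ (by simp) (by simp [gridDist])
          (by simp [gridDist])
        rw [mem_diagChain]; omega
      · refine hasTwoNeighbors_of_pair hBR (r := (c, b + 2)) ?_ (by simp) (by simp [gridDist])
          (by simp only [gridDist]; omega)
        rw [mem_diagChain]; omega
    · rintro ⟨x, y⟩ hp
      simp only [Finset.mem_insert, Finset.mem_erase, Prod.mk.injEq, ne_eq]
      rw [mem_diagChain] at hp ⊢
      omega

theorem reshapes_removeRows (hac : a ≤ c) (i : ℕ) (hi : b + i ≤ d) :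
    Reshapes (diagChain a b c d s) (diagChain a (b + i) c d s) := by
  induction i with
  | zero => simp [Reshapes.refl]
  | succ i ih =>
    push_cast at hi ⊢
    rw [← add_assoc]
    exact (ih (by omega)).trans (reshapes_removeBottom hac (by omega) (by omega))

theorem reshapes_removeLeft (hs : (s - (c + b)) % 2 = 0) (h : (c - a) % 2 = 1) :
    Reshapes (diagChain a b c b s) (diagChain (a + 1) b c b s) := by
  apply reshapes_of_subset
  rintro ⟨x, y⟩ hp
  rw [mem_diagChain] at hp ⊢
  omega

/-! ### Sweeping the rows -/

/-- The case of a single row. If its length is even, a chain has one coin more than half of the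
length, but this coin is not lost: either the left end of the chain is itself to be occupied, or
the chain can do without this end. -/
theorem boardReaches_row (hac : a ≤ c) (hs : (s - (c + b)) % 2 = 0) {N : ℕ} {X Y : Config}
    (hY : Y ⊆ rect a b c b) (h₁ : (c - a + 1) / 2 + 1 + X.card + 2 ≤ (N : ℤ))
    (h₂ : Y.card + (c - a + 2) / 2 + 2 + X.card ≤ (N : ℤ)) :
    BoardReaches N (diagChain a b c b s ∪ X) (X ∪ Y) := by
  have hP := card_diagChain_le (d := b) hac le_rfl (Or.inr hs)
  have finish : ∀ {a' : ℤ} {Z : Config}, BoardReaches N (diagChain a b c b s ∪ X)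
      (diagChain a' b c b s ∪ (X ∪ Z)) → Y ⊆ diagChain a' b c b s ∪ Z →
      BoardReaches N (diagChain a b c b s ∪ X) (X ∪ Y) := by
    intro a' Z h hYZ
    refine h.trans (boardReaches_of_subset ?_ h.2.1)
    intro p hp
    rcases Finset.mem_union.1 hp with hp | hp
    · simp [hp]
    · rcases Finset.mem_union.1 (hYZ hp) with hp | hp <;> simp [hp]
  by_cases hodd : (c - a) % 2 = 0
  · exact finish (boardReaches_place hac X Y hY (by omega)) Finset.subset_union_right
  · by_cases hTL : (a, b) ∈ Y
    · have hcard := Finset.card_erase_add_one hTL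
      refine finish (boardReaches_place hac X (Y.erase (a, b))
        ((Finset.erase_subset _ _).trans hY) (by omega)) ?_
      intro p hp
      by_cases hpa : p = (a, b)
      · subst hpa
        refine Finset.mem_union_left _ ?_
        rw [mem_diagChain]; omega
      · exact Finset.mem_union_right _ (Finset.mem_erase.2 ⟨hpa, hp⟩)
    · have hP' := card_diagChain_le (a := a + 1) (b := b) (c := c) (d := b) (s := s) (by omega)
        le_rfl (Or.inr hs)
      have hle := (reshapes_removeLeft (a := a) hs (by omega)).2 X N (by omega)
      refine finish (a' := a + 1) (hle.trans (boardReaches_place (by omega) X Y ?_ (by omega)))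
        Finset.subset_union_right
      rintro ⟨x, y⟩ hp
      have hp' := hY hp
      rw [mem_rect] at hp' ⊢
      have : x ≠ a := by
        rintro rfl
        exact hTL (by rwa [show y = b by omega] at hp)
      omega

theorem card_filter_add (Y : Config) (t : ℤ) :
    (Y.filter (fun p => p.2 < t)).card + (Y.filter (fun p => t ≤ p.2)).card = Y.card := by
  have := Finset.card_filter_add_card_filter_not (s := Y) (fun p => p.2 < t)
  simpa only [not_lt] using this

/-- Filling the rows from the top to the bottom. When a row is full, the chain is retracted to the
rows below it. -/
theorem boardReaches_sweep (hac : a ≤ c) {N : ℕ} {Y : Config} (n : ℕ) (X : Config)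
    (hdn : d = b + n) (hs : (s - (c + b)) % 2 = 0) (hY : Y ⊆ rect a b c d)
    (h₁ : (c - a + (d - b) + 1) / 2 + 1 + X.card + 2 ≤ (N : ℤ))
    (h₂ : Y.card + (c - a + 2) / 2 + 2 + X.card ≤ (N : ℤ))
    (h₃ : ∀ t, b < t → t ≤ d → (Y.filter fun p => t ≤ p.2).card +
      ((c - a + (t - b) + 1) / 2 + 1) + 2 + X.card ≤ (N : ℤ)) :
    BoardReaches N (diagChain a b c d s ∪ X) (X ∪ Y) := by
  induction n generalizing X Y d with
  | zero =>
    obtain rfl : d = b := by simpa using hdn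
    exact boardReaches_row hac hs hY (by simpa using h₁) h₂
  | succ n ih =>
    push_cast at hdn
    have hP := card_diagChain_le (d := d) hac (by omega) (Or.inr hs)
    set T := Y.filter fun p => d ≤ p.2 with hT
    set Y' := Y.filter fun p => p.2 < d with hY'
    have hTY : T ⊆ Y := Finset.filter_subset _ _
    have hXT := Finset.card_union_le X T
    have hsplit : Y'.card + T.card = Y.card := card_filter_add Y d
    have hd := h₃ d (by omega) le_rfl
    rw [← hT] at hd
    have hplace := boardReaches_place (s := s) hac X T (hTY.trans hY) (N := N) (by omega)
    have hret := (reshapes_removeTop (s := s) (t := s) hac (show b < d by omega) (by omega)).2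
      (X ∪ T) N (by omega)
    have hYeq : X ∪ Y = X ∪ T ∪ Y' := by
      ext p
      simp only [Finset.mem_union, hT, hY', Finset.mem_filter]
      have := le_or_gt d p.2
      tauto
    rw [hYeq]
    refine (hplace.trans hret).trans (ih (d := d - 1) (Y := Y') (X ∪ T) (by omega) ?_ (by omega)
      (by omega) ?_)
    · rintro ⟨x, y⟩ hp
      obtain ⟨hp, hp'⟩ := Finset.mem_filter.1 hp
      have := hY hp
      rw [mem_rect] at this ⊢
      simp only at hp'
      omega
    · intro t ht htd
      have hlt := h₃ t ht (by omega)
      have hdis : (Y'.filter fun p => t ≤ p.2).card + T.card ≤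
          (Y.filter fun p => t ≤ p.2).card := by
        rw [← Finset.card_union_of_disjoint]
        · apply Finset.card_le_card
          intro p hp
          simp only [Finset.mem_union, hT, hY', Finset.mem_filter] at hp ⊢
          rcases hp with hp | hp
          · exact ⟨hp.1.1, hp.2⟩
          · exact ⟨hp.1, by omega⟩
        · rw [Finset.disjoint_left]
          intro p hp hp'
          simp only [hT, hY', Finset.mem_filter] at hp hp'
          omega
      omega

/-- Any small enough set `Y` of positions can be filled from a minimum chain. Sweeping the rows from
the top needs the prefix bounds of `boardReaches_sweep`. If one of these fails for the rows from `t`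
upwards, then few coins remain for the rows below `t`: few enough to place them all at once, and
at most one for every two rows, so that retracting the chain to the upper rows pays for them. -/
theorem boardReaches_of_card_le (hac : a ≤ c) {N : ℕ} {Y : Config} (n : ℕ) (X : Config)
    (hdn : d = b + n) (hs : (s - (a + d)) % 2 = 0) (hY : Y ⊆ rect a b c d)
    (h₁ : Y.card + 3 + 2 * X.card + 2 * ((c - a + (d - b) + 1) / 2 + 1) ≤ 2 * (N : ℤ))
    (h₂ : Y.card + (c - a + 2) / 2 + 2 + X.card ≤ (N : ℤ)) :
    BoardReaches N (diagChain a b c d s ∪ X) (X ∪ Y) := by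
  induction n using Nat.strong_induction_on generalizing X Y b with
  | _ n ih =>
    have hbd : b ≤ d := by omega
    have hP := card_diagChain_le hac hbd (Or.inl hs)
    by_cases hbad : ∀ t, b < t → t ≤ d → (Y.filter fun p => t ≤ p.2).card +
      ((c - a + (t - b) + 1) / 2 + 1) + 2 + X.card ≤ (N : ℤ)
    · exact ((reshapes_diagChain_parity (s := s) (t := c + b) hac hbd (by omega)).2 X N
        (by omega)).trans (boardReaches_sweep hac n X hdn (by omega) hY (by omega) h₂ hbad)
    · push Not at hbad
      obtain ⟨t, htb, htd, ht⟩ := hbad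
      set T := Y.filter fun p => p.2 < t with hT
      set Y' := Y.filter fun p => t ≤ p.2 with hY'
      have hTY : T ⊆ Y := Finset.filter_subset _ _
      have hXT := Finset.card_union_le X T
      have hsplit : T.card + Y'.card = Y.card := card_filter_add Y t
      -- `ht` and `h₁` leave two coins in hand beyond those for `T`; `ht` and `h₂` give
      -- `T.card ≤ (t - b) / 2`, which preserves `h₁` when the chain is retracted.
      have hplace := boardReaches_place (s := s) hac X T (hTY.trans hY) (N := N) (by omega)
      have hret := (reshapes_removeRows (s := s) (b := b) (d := d) hac (t - b).toNat
        (by omega)).2 (X ∪ T) N (by omega)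
      rw [show b + ((t - b).toNat : ℤ) = t by omega] at hret
      have hYeq : X ∪ Y = X ∪ T ∪ Y' := by
        ext p
        simp only [Finset.mem_union, hT, hY', Finset.mem_filter]
        have := le_or_gt t p.2
        tauto
      rw [hYeq]
      refine (hplace.trans hret).trans (ih (d - t).toNat (by omega) (b := t) (Y := Y') (X ∪ T)
        (by omega) ?_ (by omega) (by omega))
      rintro ⟨x, y⟩ hp
      obtain ⟨hp, hp'⟩ := Finset.mem_filter.1 hp
      have := hY hp
      rw [mem_rect] at this ⊢
      simp only at hp'
      omega

/-! ### Canonical chains -/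

theorem span_subset_rect {L : Config} (hL : L ⊆ rect a b c d) :
    span L ⊆ (rect a b c d : Set Pos) := by
  refine Set.iUnion_subset fun i => ?_
  induction i with
  | zero => exact_mod_cast hL
  | succ i ih =>
    refine Set.union_subset ih ?_
    rintro ⟨x, y⟩ ⟨-, ⟨x₁, y₁⟩, h₁, ⟨x₂, y₂⟩, h₂, hne, hd₁, hd₂⟩
    have h₁ := Finset.mem_coe.1 (ih h₁)
    have h₂ := Finset.mem_coe.1 (ih h₂)
    rw [Finset.mem_coe]
    rw [mem_rect] at h₁ h₂ ⊢
    simp only [gridDist] at hd₁ hd₂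
    rw [ne_eq, Prod.mk.injEq] at hne
    omega

/-- Steps of length at most two cannot jump over two consecutive diagonals. -/
theorem lt_of_isChain_of_gap {l : List Pos} {t : ℤ}
    (hl : l.IsChain fun p q => gridDist p q = 1 ∨ gridDist p q = 2)
    (hgap : ∀ p ∈ l, p.1 - p.2 ≠ t ∧ p.1 - p.2 ≠ t + 1) {p : Pos} (hp : l.head? = some p)
    (hpt : p.1 - p.2 < t) : ∀ q ∈ l, q.1 - q.2 < t := by
  induction l generalizing p with
  | nil => simp
  | cons x l ih =>
    obtain rfl : x = p := by simpa using hp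
    intro q hq
    rcases List.mem_cons.1 hq with rfl | hq
    · exact hpt
    · cases l with
      | nil => simp at hq
      | cons y l =>
        obtain ⟨hxy, hl'⟩ := List.isChain_cons_cons.1 hl
        refine ih hl' (fun p hp => hgap p (List.mem_cons_of_mem _ hp)) rfl ?_ q hq
        have := hgap y (by simp)
        simp only [gridDist] at hxy
        omega

theorem IsCanonicalL.subset_rect {m n : ℕ} {L : Config} (hL : IsCanonicalL a b m n L)
    (hm : 1 ≤ m) (hn : 1 ≤ n) : L ⊆ rect a b (a + m - 1) (b + n - 1) := by
  rintro ⟨x, y⟩ hp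
  have := hL.hugs _ hp
  rw [mem_rect]
  simp only at this
  omega

theorem IsCanonicalL.cornerDense {m n : ℕ} {L : Config} (hL : IsCanonicalL a b m n L) :
    CornerDense a b (a + m - 1) (b + n - 1) L := by
  obtain ⟨l, rfl, hhead, hlast, hl⟩ := hL.chain
  refine ⟨by simpa using List.mem_of_mem_head? hhead,
    by simpa using List.mem_of_getLast? hlast, fun t ht => ?_⟩
  by_contra hcon
  push Not at hcon
  have hgap : ∀ p ∈ l, p.1 - p.2 ≠ a - (b + n - 1) + t ∧ p.1 - p.2 ≠ a - (b + n - 1) + t + 1 := by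
    rintro ⟨x, y⟩ hp
    have hug := hL.hugs (x, y) (by simpa using hp)
    simp only at hug ⊢
    constructor <;> intro e
    · exact hcon.1 (by
        rw [(cornerPath_eq (x := x) (y := y)).2 ⟨by omega, by omega⟩]; simpa using hp)
    · exact hcon.2 (by
        rw [(cornerPath_eq (x := x) (y := y)).2 ⟨by omega, by push_cast; omega⟩]; simpa using hp)
  have h0 := (hgap _ (List.mem_of_mem_head? hhead)).1
  have := lt_of_isChain_of_gap hl hgap hhead (by simp only at h0 ⊢; omega) _
    (List.mem_of_getLast? hlast)
  simp only at this
  omega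

/-! ### Exchanging the coordinates -/

/-- The reflection of a configuration in the diagonal `x = y`. -/
def reflect (A : Config) : Config := A.map (Equiv.prodComm ℤ ℤ).toEmbedding

theorem mem_reflect {A : Config} {x y : ℤ} : (x, y) ∈ reflect A ↔ (y, x) ∈ A := by
  simp [reflect]

theorem card_reflect (A : Config) : (reflect A).card = A.card := Finset.card_map _

theorem reflect_reflect (A : Config) : reflect (reflect A) = A := by
  ext ⟨x, y⟩; simp [mem_reflect]

theorem reflect_erase (A : Config) (p : Pos) : reflect (A.erase p) = (reflect A).erase p.swap := by
  ext ⟨x, y⟩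
  simp only [mem_reflect, Finset.mem_erase, ne_eq, Prod.ext_iff, Prod.fst_swap, Prod.snd_swap]
  tauto

theorem reflect_insert (A : Config) (p : Pos) :
    reflect (insert p A) = insert p.swap (reflect A) := by
  ext ⟨x, y⟩
  simp only [mem_reflect, Finset.mem_insert, Prod.ext_iff, Prod.fst_swap, Prod.snd_swap]
  tauto

theorem swap_mem_reflect {A : Config} {p : Pos} : p.swap ∈ reflect A ↔ p ∈ A := by
  obtain ⟨x, y⟩ := p
  exact mem_reflect

theorem hasTwoNeighbors_reflect {A : Config} {p : Pos} (h : HasTwoNeighbors A p) :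
    HasTwoNeighbors (reflect A) p.swap := by
  obtain ⟨q, hq, r, hr, hqr, hpq, hpr⟩ := h
  refine hasTwoNeighbors_of_pair (swap_mem_reflect.2 hq) (swap_mem_reflect.2 hr)
    (fun h => hqr (Prod.swap_injective h)) ?_ ?_
  · simp only [gridDist, Prod.fst_swap, Prod.snd_swap] at hpq ⊢; omega
  · simp only [gridDist, Prod.fst_swap, Prod.snd_swap] at hpr ⊢; omega

theorem step_reflect {S T : Config × ℕ} (h : Step S T) :
    Step (reflect S.1, S.2) (reflect T.1, T.2) := by
  cases h with
  | move A k c p hc hp h =>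
    have := hasTwoNeighbors_reflect h
    rw [reflect_erase] at this
    simpa only [reflect_insert, reflect_erase] using Step.move (reflect A) k c.swap p.swap
      (swap_mem_reflect.2 hc) (fun h => hp (swap_mem_reflect.1 h)) this
  | pickUp A k c hc =>
    simpa only [reflect_erase] using Step.pickUp (reflect A) k c.swap (swap_mem_reflect.2 hc)
  | drop A k p hp h =>
    simpa only [reflect_insert] using Step.drop (reflect A) k p.swap
      (fun h => hp (swap_mem_reflect.1 h)) (hasTwoNeighbors_reflect h)

theorem boardReaches_reflect {N : ℕ} {A B : Config} (h : BoardReaches N A B) :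
    BoardReaches N (reflect A) (reflect B) := by
  refine ⟨by rw [card_reflect]; exact h.1, by rw [card_reflect]; exact h.2.1, ?_⟩
  rw [card_reflect, card_reflect]
  exact h.2.2.lift (fun S : Config × ℕ => (reflect S.1, S.2)) fun _ _ => step_reflect

theorem reflect_diagChain (a b c d s : ℤ) :
    reflect (diagChain a b c d s) = diagChain b a d c s := by
  ext ⟨x, y⟩
  rw [mem_reflect, mem_diagChain, mem_diagChain]
  omega

end CoinGame

open CoinGame in
theorem mainTheorem9 (m n : ℕ) (hm : 1 ≤ m) (hn : 1 ≤ n) (a b : ℤ)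
    (L : CoinGame.Config) (hL : CoinGame.IsCanonicalL a b m n L) (k : ℕ)
    (C : CoinGame.Config) (hC : (C : Set CoinGame.Pos) ⊆ CoinGame.span L)
    (hcard : (C.card : ℤ) <
      min (⌈((m : ℚ) + n) / 2⌉ - ⌈min (m : ℚ) n / 2⌉ + ((k : ℤ) - 1)) (2 * ((k : ℤ) - 1))) :
    ∃ k' : ℕ, (k' : ℤ) = (k : ℤ) + L.card - C.card ∧ CoinGame.Reaches L k C k' := by
  have hCR : C ⊆ rect a b (a + m - 1) (b + n - 1) := by
    exact_mod_cast hC.trans (span_subset_rect (hL.subset_rect hm hn))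
  have ceil_half : ∀ i : ℕ, ⌈(i : ℚ) / 2⌉ = ((i : ℤ) + 1) / 2 := by
    intro i
    rw [Int.ceil_eq_iff]
    have h₁ : 2 * (((i : ℤ) + 1) / 2) ≤ (i : ℤ) + 1 := by omega
    have h₂ : (i : ℤ) ≤ 2 * (((i : ℤ) + 1) / 2) := by omega
    have h₁' : (2 : ℚ) * ((((i : ℤ) + 1) / 2 : ℤ) : ℚ) ≤ (i : ℚ) + 1 := by exact_mod_cast h₁
    have h₂' : (i : ℚ) ≤ 2 * ((((i : ℤ) + 1) / 2 : ℤ) : ℚ) := by exact_mod_cast h₂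
    constructor <;> linarith
  rw [lt_min_iff, ← Nat.cast_add, ← Nat.cast_min, ceil_half, ceil_half] at hcard
  obtain ⟨hcard₁, hcard₂⟩ := hcard
  push_cast at hcard₁
  have hdense := hL.cornerDense
  have hLcard := hdense.card_le (by omega) (by omega)
  suffices h : BoardReaches (k + L.card) L C by
    obtain ⟨-, hle, h⟩ := h
    refine ⟨k + L.card - C.card, by omega, ?_⟩
    rwa [Nat.add_sub_cancel] at h
  have hshape : ∀ s, ((s - (a + (b + n - 1))) % 2 = 0 ∨ (s - (a + m - 1 + b)) % 2 = 0) →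
      BoardReaches (k + L.card) L (diagChain a b (a + m - 1) (b + n - 1) s) := by
    intro s hs
    simpa using (hdense.reshapes_diagChain (by omega) (by omega) hs).2 ∅ (k + L.card)
      (by simp only [Finset.card_empty]; omega)
  rcases le_total m n with hmn | hmn
  · have h := boardReaches_of_card_le (a := a) (b := b) (c := a + m - 1) (d := b + n - 1)
      (s := a + (b + n - 1)) (by omega) (N := k + L.card) (n - 1) ∅ (by omega) (by simp) hCR
      (by simp only [Finset.card_empty]; push_cast; omega)
      (by simp only [Finset.card_empty]; push_cast; omega)
    rw [Finset.union_empty, Finset.empty_union] at h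
    exact (hshape _ (Or.inl (by simp))).trans h
  · have h := boardReaches_of_card_le (a := b) (b := a) (c := b + n - 1) (d := a + m - 1)
      (s := a + m - 1 + b) (by omega) (N := k + L.card) (Y := reflect C) (m - 1) ∅ (by omega)
      (by omega)
      (by
        rintro ⟨x, y⟩ hp
        have := hCR (mem_reflect.1 hp)
        rw [mem_rect] at this ⊢
        exact this.symm)
      (by rw [card_reflect]; simp only [Finset.card_empty]; push_cast; omega)
      (by rw [card_reflect]; simp only [Finset.card_empty]; push_cast; omega)
    rw [Finset.union_empty, Finset.empty_union] at h
    have h' := boardReaches_reflect h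
    rw [reflect_diagChain, reflect_reflect] at h'
    exact (hshape _ (Or.inr (by simp))).trans h'
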